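/- Let $\mathbb T^n=(\mathbb R/2\pi\mathbb Z)^n$ with normalized Lebesgue measure, and identify (formal) Fourier series $U(y)=\sum_{k\in\mathbb Z^n}\widehat U_k e^{\mathrm i k\cdot y}$ on $\mathbb T^n$ with their complex coefficients; $|\cdot|$ is the Euclidean norm. Let $P\in\mathbb R^{d\times n}$ have columns that are linearly independent over $\mathbb Q$. For $\sigma\in\mathbb R$ let $$H_0^{\sigma}(\mathbb T^n)=\Big\{U:\widehat U_0=0,\ \|U\|_{H^{\sigma}}^2=\sum_{k}(1+|k|^2)^{\sigma}|\widehat U_k|^2<\infty\Big\},\qquad \overline H^{\sigma}_{P,0}(\mathbb T^n)=\Big\{U:\widehat U_0=0,\ \|U\|_{\overline H^{\sigma}_{P,0}}^2=\sum_{k\ne0}|Pk|^{2\sigma}|\widehat U_k|^2<\infty\Big\},$$ and $\|U\|_{L^2}^2=\sum_k|\widehat U_k|^2$. For $U\in\overline H^1_{P,0}(\mathbb T^n)$ let $P\nabla U=\sum_{k}\mathrm i\,(Pk)\,\widehat U_k e^{\mathrm i k\cdot y}\in L^2(\mathbb T^n;\mathbb C^d)$. Let $s\ge 0$. Assume that *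 there are $c>0$ and $\tau>0$ with $|Pk|\ge c|k|^{-\tau}$ for all $k\in\mathbb Z^n\setminus\{0\}$; * $A:\mathbb T^n\to\mathbb R$ is measurable with $0<\alpha_0\le A(y)\le\alpha_1<\infty$ for all $y$, and $|\widehat A_k|\le C_A(1+|k|)^{-N}$ for all $k\in\mathbb Z^n$, where $N>n+s+\tau$; * $F\in H_0^{2\tau+s+1}(\mathbb T^n)$. Then there is a unique $U\in\overline H^1_{P,0}(\mathbb T^n)$ such that $$\int_{\mathbb T^n}A\,P\nabla U\cdot\overline{P\nabla V}\,dy=\sum_{k\ne0}\widehat F_k\overline{\widehat V_k}\qquad\text{for all }V\in\overline H^1_{P,0}(\mathbb T^n),$$ this $U$ belongs to $H_0^{s+1}(\mathbb T^n)$, and for every $K>0$ its Fourier truncation $\Pi_KU=\sum_{0<|k|\le K}\widehat U_k e^{\mathrm i k\cdot y}$ satisfies $$\|U-\Pi_KU\|_{\overline H^1_{P,0}}\le C K^{-s}\|U\|_{H^{s+1}},\qquad \|U-\Pi_KU\|_{L^2}\le C K^{-(s+1)}\|U\|_{H^{s+1}},$$ with a constant $C>0$ depending only on $P$ (in particular not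 on $s$, $A$, $F$, $U$ or $K$). -/

import Mathlib

open MeasureTheory
open scoped ComplexConjugate

noncomputable section

namespace QuasiPer

/-- The torus `(ℝ / 2πℤ)ⁿ`. -/
abbrev Torus (n : ℕ) : Type := Fin n → AddCircle (2 * Real.pi)

/-- Needed for the Haar measure and the Fourier monomials of `ℝ / 2πℤ`. -/
instance fact_two_pi_pos : Fact (0 < 2 * Real.pi) := ⟨Real.two_pi_pos⟩

/-- The normalized (total mass one) Lebesgue measure on the torus. -/
abbrev torusMeasure (n : ℕ) : Measure (Torus n) :=
  Measure.pi fun _ => AddCircle.haarAddCircle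

/-- The monomial `y ↦ exp (i k ⬝ y)`; Mathlib's `fourier m` on `AddCircle (2π)` is
`y ↦ exp (i m y)`. -/
def monomial {n : ℕ} (k : Fin n → ℤ) : C(Torus n, ℂ) where
  toFun y := ∏ i, fourier (k i) (y i)
  continuous_toFun := by fun_prop

/-- The monomial `exp (i k ⬝ y)` as an element of `L²` of the torus. -/
def monomialL2 {n : ℕ} (k : Fin n → ℤ) : Lp ℂ 2 (torusMeasure n) :=
  ContinuousMap.toLp 2 (torusMeasure n) ℂ (monomial k)

/-- The `k`-th Fourier coefficient of a real function on the torus. -/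
def fourierCoeffReal {n : ℕ} (A : Torus n → ℝ) (k : Fin n → ℤ) : ℂ :=
  ∫ y, (A y : ℂ) * conj (monomial k y) ∂(torusMeasure n)

/-- The Euclidean length `|k|` of an integer vector. -/
def freqNorm {n : ℕ} (k : Fin n → ℤ) : ℝ :=
  √(∑ i, (k i : ℝ) ^ 2)

/-- The projected frequency `P k`. -/
def projFreq {d n : ℕ} (P : Matrix (Fin d) (Fin n) ℝ) (k : Fin n → ℤ) : Fin d → ℝ :=
  P.mulVec fun i => (k i : ℝ)

/-- The Euclidean length `|P k|` of a projected frequency. -/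
def projNorm {d n : ℕ} (P : Matrix (Fin d) (Fin n) ℝ) (k : Fin n → ℤ) : ℝ :=
  √(∑ j, projFreq P k j ^ 2)

/-- `P` is a projection matrix: its columns are linearly independent over `ℚ`. -/
def IsProjectionMatrix {d n : ℕ} (P : Matrix (Fin d) (Fin n) ℝ) : Prop :=
  LinearIndependent ℚ fun i : Fin n => P.col i

/-- The Diophantine condition with exponent `τ`: `|P k| ≥ c |k|^{-τ}` for all `k ≠ 0`. -/
def IsDiophantine {d n : ℕ} (P : Matrix (Fin d) (Fin n) ℝ) (τ : ℝ) : Prop :=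
  0 < τ ∧ ∃ c : ℝ, 0 < c ∧ ∀ k : Fin n → ℤ, k ≠ 0 → c * freqNorm k ^ (-τ) ≤ projNorm P k

/-- The coefficient has positive lower and finite upper bounds. -/
def IsElliptic {n : ℕ} (A : Torus n → ℝ) : Prop :=
  ∃ α₀ α₁ : ℝ, 0 < α₀ ∧ ∀ y, α₀ ≤ A y ∧ A y ≤ α₁

/-- The Fourier coefficients of `A` decay at rate `N`. -/
def HasFourierDecay {n : ℕ} (A : Torus n → ℝ) (N : ℝ) : Prop :=
  ∃ CA : ℝ, 0 < CA ∧ ∀ k : Fin n → ℤ, ‖fourierCoeffReal A k‖ ≤ CA * (1 + freqNorm k) ^ (-N)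

/-- A formal Fourier series `∑ k, U k * exp (i k ⬝ y)` on the torus, given by its coefficients.
The function spaces below are spaces of such series: an element of the homogeneous `P`-projected
space of order one need not be square integrable. -/
abbrev FourierSeries (n : ℕ) : Type := (Fin n → ℤ) → ℂ

/-- The norm of `L²` of the torus, in terms of Fourier coefficients. -/
def normL2 {n : ℕ} (U : FourierSeries n) : ℝ :=
  √(∑' k, ‖U k‖ ^ 2)

/-- The norm of the Sobolev space `H^s` of the torus. -/
def normH {n : ℕ} (s : ℝ) (U : FourierSeries n) : ℝ :=
  √(∑' k, (1 + freqNorm k ^ 2) ^ s * ‖U k‖ ^ 2)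

/-- The space `H_0^s` of the torus: zero mean and finite `H^s` norm. -/
def H0 (n : ℕ) (s : ℝ) : Set (FourierSeries n) :=
  {U | U 0 = 0 ∧ Summable fun k => (1 + freqNorm k ^ 2) ^ s * ‖U k‖ ^ 2}

/-- The norm of the homogeneous `P`-projected space of order `s`. It is used for series with
`U 0 = 0`, so that the term `k = 0` vanishes for every real `s`. -/
def normHbarP {d n : ℕ} (P : Matrix (Fin d) (Fin n) ℝ) (s : ℝ) (U : FourierSeries n) : ℝ :=
  √(∑' k, projNorm P k ^ (2 * s) * ‖U k‖ ^ 2)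

/-- The zero-mean homogeneous `P`-projected space of order `s`. -/
def HbarP0 {d n : ℕ} (P : Matrix (Fin d) (Fin n) ℝ) (s : ℝ) : Set (FourierSeries n) :=
  {U | U 0 = 0 ∧ Summable fun k => projNorm P k ^ (2 * s) * ‖U k‖ ^ 2}

/-- The `j`-th component of `P ∇ U`, the `L²` function `∑ k, i (P k)_j U_k exp (i k ⬝ y)`.
The series converges unconditionally in `L²` when `U ∈ HbarP0 P 1`. -/
def projGrad {d n : ℕ} (P : Matrix (Fin d) (Fin n) ℝ) (U : FourierSeries n) (j : Fin d) :
    Lp ℂ 2 (torusMeasure n) :=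
  ∑' k, (Complex.I * (projFreq P k j : ℂ) * U k) • monomialL2 k

/-- The form `a(U, V) = (A P∇U, P∇V)`, an integral over the torus. -/
def energyForm {d n : ℕ} (P : Matrix (Fin d) (Fin n) ℝ) (A : Torus n → ℝ)
    (U V : FourierSeries n) : ℂ :=
  ∫ y, (A y : ℂ) * ∑ j, projGrad P U j y * conj (projGrad P V j y) ∂(torusMeasure n)

/-- The duality pairing `⟨F, V⟩` extending the `L²` inner product. -/
def pairing {n : ℕ} (F V : FourierSeries n) : ℂ :=
  ∑' k, F k * conj (V k)

/-- `U` solves the variational problem: `U ∈ HbarP0 P 1` and `a(U, V) = ⟨F, V⟩` for every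
`V ∈ HbarP0 P 1`. -/
def IsVariationalSolution {d n : ℕ} (P : Matrix (Fin d) (Fin n) ℝ) (A : Torus n → ℝ)
    (F U : FourierSeries n) : Prop :=
  U ∈ HbarP0 P 1 ∧ ∀ V ∈ HbarP0 P 1, energyForm P A U V = pairing F V

open Classical in
/-- The Fourier truncation `Π_K U`, keeping the frequencies `0 < |k| ≤ K`. -/
def fourierTrunc {n : ℕ} (K : ℝ) (U : FourierSeries n) : FourierSeries n :=
  fun k => if 0 < freqNorm k ∧ freqNorm k ≤ K then U k else 0

end QuasiPer

end

open QuasiPer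

/-! The substitution `u k = |Pk| * U k` identifies the energy space with `ℓ²` over the nonzero
frequencies and removes the small divisors from the form. It becomes a bounded operator `T` with
matrix entries `cos θ(k,l) * Â(k - l)`, where `θ(k,l)` is the angle between `Pk` and `Pl`. Since
`P∇` is an isometry in these coordinates, `A ≥ α₀` makes `T` coercive. The problem reads `T u = f`
with `f k = F k / |Pk|`, so Lax–Milgram (`isUnit_of_coercive`) gives existence and uniqueness.

Regularity means that weighted summability of `f` passes to `u` (`summable_weighted_of_coercive`).
Conjugating `T` by the weight `W k = max R |k| ^ σ` gives `T + S`, where `S` has entries `(W k / W l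
- 1) * T k l`. The central point (`exists_small_conjugation_error`) is that `‖S‖` can be made
smaller than any given bound by choosing `R` large. Near the diagonal `W k / W l` is close to 1, and
the Schur test applies. Away from it, the decay of `Â` beats the growth of the weight and leaves a
kernel dominated by `|k|^(-p) |l|^(-p)` times a negative power of `R`. Hence `T + S` is still
coercive, and its solution with right-hand side `W f` must be `W u`.

The Diophantine bound enters only in passing from `F` to `f` and from `u` to `U`, each at the cost
of `τ` derivatives. The truncation estimates compare weights on the tail `|k| > K`, using `|Pk| ≤ C
|k|`. -/

namespace QuasiPer

/-! ### Bounded operators on `ℓ²` given by infinite matrices. -/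

section SequenceSpace

variable {ι : Type*}

theorem memℓp_two_iff_summable_sq {f : ι → ℂ} :
    Memℓp f 2 ↔ Summable fun i => ‖f i‖ ^ 2 := by
  rw [memℓp_gen_iff (by norm_num)]
  simp

theorem lp_two_summable_sq (u : lp (fun _ : ι => ℂ) 2) : Summable fun i => ‖u i‖ ^ 2 :=
  memℓp_two_iff_summable_sq.1 (lp.memℓp u)

theorem lp_two_norm_sq (u : lp (fun _ : ι => ℂ) 2) : ‖u‖ ^ 2 = ∑' i, ‖u i‖ ^ 2 := by
  have h := lp.norm_rpow_eq_tsum (p := 2) (by norm_num) u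
  simpa using h

theorem lp_two_norm_le_of_sum_sq_le {C : ℝ} (hC : 0 ≤ C) (u : lp (fun _ : ι => ℂ) 2)
    (h : ∀ s : Finset ι, ∑ i ∈ s, ‖u i‖ ^ 2 ≤ C ^ 2) : ‖u‖ ≤ C := by
  refine lp.norm_le_of_forall_sum_le (by norm_num) hC fun s => ?_
  simpa using h s

theorem lp_two_apply_sq_le (u : lp (fun _ : ι => ℂ) 2) (i : ι) : ‖u i‖ ^ 2 ≤ ‖u‖ ^ 2 :=
  pow_le_pow_left₀ (norm_nonneg _) (lp.norm_apply_le_norm (by norm_num) u i) 2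

/-- Two operators on `ℓ²` with the same matrix agree. -/
theorem lp_two_clm_ext [DecidableEq ι] {F : Type*} [NormedAddCommGroup F] [NormedSpace ℂ F]
    {S T : lp (fun _ : ι => ℂ) 2 →L[ℂ] F}
    (h : ∀ i, S (lp.single 2 i 1) = T (lp.single 2 i 1)) : S = T := by
  refine lp.ext_continuousLinearMap (by norm_num) fun i => ?_
  ext
  simpa using h i

/-- An infinite matrix whose rows act on square summable sequences with a uniform bound defines
a bounded operator. -/
theorem exists_clm_of_matrix [DecidableEq ι] (E : ι → ι → ℂ) {C : ℝ} (hC : 0 ≤ C)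
    (hsum : ∀ (u : lp (fun _ : ι => ℂ) 2) k, Summable fun l => E k l * u l)
    (hbd : ∀ (u : lp (fun _ : ι => ℂ) 2) (s : Finset ι),
      ∑ k ∈ s, ‖∑' l, E k l * u l‖ ^ 2 ≤ (C * ‖u‖) ^ 2) :
    ∃ S : lp (fun _ : ι => ℂ) 2 →L[ℂ] lp (fun _ : ι => ℂ) 2,
      ‖S‖ ≤ C ∧ ∀ k l, S (lp.single 2 l 1) k = E k l := by
  have hmem : ∀ u : lp (fun _ : ι => ℂ) 2, Memℓp (fun k => ∑' l, E k l * u l) 2 := fun u =>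
    memℓp_two_iff_summable_sq.2
      (summable_of_sum_le (fun _ => by positivity) (hbd u))
  let S₀ : lp (fun _ : ι => ℂ) 2 →ₗ[ℂ] lp (fun _ : ι => ℂ) 2 :=
    { toFun := fun u => ⟨fun k => ∑' l, E k l * u l, hmem u⟩
      map_add' := fun u v => by
        ext k
        simp only [lp.coeFn_add, Pi.add_apply, mul_add]
        exact (hsum u k).tsum_add (hsum v k)
      map_smul' := fun c u => by
        ext k
        simp only [lp.coeFn_smul, Pi.smul_apply, smul_eq_mul, RingHom.id_apply]
        rw [← tsum_mul_left]
        exact tsum_congr fun l => by ring }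
  refine ⟨S₀.mkContinuous C fun u => ?_, LinearMap.mkContinuous_norm_le _ hC _, fun k l => ?_⟩
  · exact lp_two_norm_le_of_sum_sq_le (by positivity) _ (hbd u)
  · change ∑' m, E k m * (lp.single 2 l (1 : ℂ) : lp (fun _ : ι => ℂ) 2) m = E k l
    rw [tsum_eq_single l]
    · simp
    · intro m hm
      simp [Pi.single_eq_of_ne hm]

/-- Cauchy–Schwarz after splitting `K * w = √K * (√K * w)`. -/
theorem sq_tsum_mul_le {K w : ι → ℝ} (hK : ∀ i, 0 ≤ K i) (hw : ∀ i, 0 ≤ w i)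
    (hKs : Summable K) (hKw : Summable fun i => K i * w i ^ 2) :
    (Summable fun i => K i * w i) ∧
      (∑' i, K i * w i) ^ 2 ≤ (∑' i, K i) * ∑' i, K i * w i ^ 2 := by
  have e1 : ∀ i, √(K i) ^ (2 : ℝ) = K i := fun i => by
    rw [Real.rpow_two, Real.sq_sqrt (hK i)]
  have e2 : ∀ i, (√(K i) * w i) ^ (2 : ℝ) = K i * w i ^ 2 := fun i => by
    rw [Real.rpow_two, mul_pow, Real.sq_sqrt (hK i)]
  have e3 : ∀ i, √(K i) * (√(K i) * w i) = K i * w i := fun i => by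
    rw [← mul_assoc, Real.mul_self_sqrt (hK i)]
  have h := Real.summable_and_inner_le_Lp_mul_Lq_tsum_of_nonneg Real.HolderConjugate.two_two
    (f := fun i => √(K i)) (g := fun i => √(K i) * w i) (fun i => by positivity)
    (fun i => mul_nonneg (by positivity) (hw i)) (by simpa only [e1]) (by simpa only [e2])
  simp only [e1, e2, e3] at h
  refine ⟨h.1, ?_⟩
  have h0 : 0 ≤ ∑' i, K i := tsum_nonneg hK
  have h1 : 0 ≤ ∑' i, K i * w i ^ 2 := tsum_nonneg fun i => mul_nonneg (hK i) (by positivity)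
  calc (∑' i, K i * w i) ^ 2
      ≤ ((∑' i, K i) ^ (1 / 2 : ℝ) * (∑' i, K i * w i ^ 2) ^ (1 / 2 : ℝ)) ^ 2 :=
        pow_le_pow_left₀ (tsum_nonneg fun i => mul_nonneg (hK i) (hw i)) h.2 2
    _ = _ := by
        rw [← Real.sqrt_eq_rpow, ← Real.sqrt_eq_rpow, mul_pow, Real.sq_sqrt h0, Real.sq_sqrt h1]

/-- The Schur test. -/
theorem exists_clm_of_schur [DecidableEq ι] (E : ι → ι → ℂ) (K : ι → ι → ℝ) {C : ℝ} (hC : 0 ≤ C)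
    (hEK : ∀ k l, ‖E k l‖ ≤ K k l)
    (hrow : ∀ k, Summable (K k)) (hrowC : ∀ k, ∑' l, K k l ≤ C)
    (hcol : ∀ l (s : Finset ι), ∑ k ∈ s, K k l ≤ C) :
    ∃ S : lp (fun _ : ι => ℂ) 2 →L[ℂ] lp (fun _ : ι => ℂ) 2,
      ‖S‖ ≤ C ∧ ∀ k l, S (lp.single 2 l 1) k = E k l := by
  have hK : ∀ k l, 0 ≤ K k l := fun k l => (norm_nonneg _).trans (hEK k l)
  have hs2 : ∀ (u : lp (fun _ : ι => ℂ) 2) k, Summable fun l => K k l * ‖u l‖ ^ 2 := fun u k =>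
    Summable.of_nonneg_of_le (fun l => mul_nonneg (hK k l) (by positivity))
      (fun l => mul_le_mul_of_nonneg_left (lp_two_apply_sq_le u l) (hK k l))
      ((hrow k).mul_right (‖u‖ ^ 2))
  have hcs : ∀ (u : lp (fun _ : ι => ℂ) 2) k, _ := fun u k =>
    sq_tsum_mul_le (hK k) (fun l => norm_nonneg (u l)) (hrow k) (hs2 u k)
  have hle : ∀ (u : lp (fun _ : ι => ℂ) 2) k l, ‖E k l * u l‖ ≤ K k l * ‖u l‖ := fun u k l => by
    rw [norm_mul]
    exact mul_le_mul_of_nonneg_right (hEK k l) (norm_nonneg _)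
  refine exists_clm_of_matrix E hC (fun u k => .of_norm_bounded (hcs u k).1 (hle u k))
    fun u s => ?_
  calc ∑ k ∈ s, ‖∑' l, E k l * u l‖ ^ 2
      ≤ ∑ k ∈ s, C * ∑' l, K k l * ‖u l‖ ^ 2 := by
        refine Finset.sum_le_sum fun k _ => ?_
        calc ‖∑' l, E k l * u l‖ ^ 2 ≤ (∑' l, K k l * ‖u l‖) ^ 2 :=
              pow_le_pow_left₀ (norm_nonneg _)
                (tsum_of_norm_bounded (hcs u k).1.hasSum (hle u k)) 2
          _ ≤ _ := (hcs u k).2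
          _ ≤ _ := mul_le_mul_of_nonneg_right (hrowC k)
              (tsum_nonneg fun l => mul_nonneg (hK k l) (by positivity))
    -- Only finitely many rows are present, so the interchange needs no double summability.
    _ = C * ∑' l, (∑ k ∈ s, K k l) * ‖u l‖ ^ 2 := by
        rw [← Finset.mul_sum, ← Summable.tsum_finsetSum fun k _ => hs2 u k]
        simp only [Finset.sum_mul]
    _ ≤ C * ∑' l, C * ‖u l‖ ^ 2 := by
        have h1 : Summable fun l => C * ‖u l‖ ^ 2 := (lp_two_summable_sq u).mul_left C
        have h2 : ∀ l, (∑ k ∈ s, K k l) * ‖u l‖ ^ 2 ≤ C * ‖u l‖ ^ 2 := fun l =>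
          mul_le_mul_of_nonneg_right (hcol l s) (by positivity)
        refine mul_le_mul_of_nonneg_left (Summable.tsum_le_tsum h2 (.of_nonneg_of_le (fun l =>
          mul_nonneg (Finset.sum_nonneg fun k _ => hK k l) (by positivity)) h2 h1) h1) hC
    _ = (C * ‖u‖) ^ 2 := by
        rw [tsum_mul_left, ← lp_two_norm_sq]
        ring

/-- An infinite matrix dominated by `φ k * φ l` with `φ` square summable. -/
theorem exists_clm_of_le_mul [DecidableEq ι] (E : ι → ι → ℂ) (φ : ι → ℝ) {C : ℝ} (hC : 0 ≤ C)
    (hE : ∀ k l, ‖E k l‖ ≤ C * (φ k * φ l)) (hφ : Summable fun k => φ k ^ 2) (h0 : ∀ k, 0 ≤ φ k) :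
    ∃ S : lp (fun _ : ι => ℂ) 2 →L[ℂ] lp (fun _ : ι => ℂ) 2,
      ‖S‖ ≤ C * ∑' k, φ k ^ 2 ∧ ∀ k l, S (lp.single 2 l 1) k = E k l := by
  set Q := ∑' k, φ k ^ 2 with hQ
  have hQ0 : 0 ≤ Q := tsum_nonneg fun _ => by positivity
  have hcs : ∀ u : lp (fun _ : ι => ℂ) 2, (Summable fun l => φ l * ‖u l‖) ∧
      (∑' l, φ l * ‖u l‖) ^ 2 ≤ Q * ‖u‖ ^ 2 := fun u => by
    have h := Real.summable_and_inner_le_Lp_mul_Lq_tsum_of_nonneg Real.HolderConjugate.two_two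
      (f := φ) (g := fun l => ‖u l‖) h0 (fun _ => norm_nonneg _) (by simpa using hφ)
      (by simpa using lp_two_summable_sq u)
    refine ⟨h.1, ?_⟩
    refine (pow_le_pow_left₀ (tsum_nonneg fun i => mul_nonneg (h0 i) (norm_nonneg _)) h.2 2).trans ?_
    simp only [Real.rpow_two]
    rw [← hQ, ← lp_two_norm_sq, ← Real.sqrt_eq_rpow, ← Real.sqrt_eq_rpow, mul_pow,
      Real.sq_sqrt hQ0, Real.sq_sqrt (by positivity)]
  have hle : ∀ (u : lp (fun _ : ι => ℂ) 2) k l,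
      ‖E k l * u l‖ ≤ C * φ k * (φ l * ‖u l‖) := fun u k l => by
    rw [norm_mul]
    calc _ ≤ C * (φ k * φ l) * ‖u l‖ := mul_le_mul_of_nonneg_right (hE k l) (norm_nonneg _)
      _ = _ := by ring
  refine exists_clm_of_matrix E (by positivity)
    (fun u k => .of_norm_bounded ((hcs u).1.mul_left _) (hle u k)) fun u s => ?_
  calc ∑ k ∈ s, ‖∑' l, E k l * u l‖ ^ 2
      ≤ ∑ k ∈ s, φ k ^ 2 * (C ^ 2 * (Q * ‖u‖ ^ 2)) := by
        refine Finset.sum_le_sum fun k _ => ?_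
        have h1 := tsum_of_norm_bounded ((hcs u).1.mul_left (C * φ k)).hasSum (hle u k)
        rw [tsum_mul_left] at h1
        calc ‖∑' l, E k l * u l‖ ^ 2 ≤ (C * φ k * ∑' l, φ l * ‖u l‖) ^ 2 :=
              pow_le_pow_left₀ (norm_nonneg _) h1 2
          _ = φ k ^ 2 * (C ^ 2 * (∑' l, φ l * ‖u l‖) ^ 2) := by ring
          _ ≤ _ := by gcongr; exact (hcs u).2
    _ ≤ Q * (C ^ 2 * (Q * ‖u‖ ^ 2)) := by
        rw [← Finset.sum_mul]
        exact mul_le_mul_of_nonneg_right (hφ.sum_le_tsum s fun _ _ => by positivity)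
          (by positivity)
    _ = _ := by ring

/-- The operator multiplying the `k`-th coordinate by `a k`. -/
noncomputable def diagOp (a : ι → ℂ) {C : ℝ} (hC : 0 ≤ C) (ha : ∀ k, ‖a k‖ ≤ C) :
    lp (fun _ : ι => ℂ) 2 →L[ℂ] lp (fun _ : ι => ℂ) 2 :=
  lp.mapCLM 2 (fun k => a k • ContinuousLinearMap.id ℂ ℂ) hC fun k => by
    rw [norm_smul]
    simpa using ha k

@[simp]
theorem diagOp_apply (a : ι → ℂ) {C : ℝ} (hC : 0 ≤ C) (ha : ∀ k, ‖a k‖ ≤ C)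
    (u : lp (fun _ : ι => ℂ) 2) (k : ι) : diagOp a hC ha u k = a k * u k := by
  simp [diagOp]

theorem diagOp_single [DecidableEq ι] (a : ι → ℂ) {C : ℝ} (hC : 0 ≤ C) (ha : ∀ k, ‖a k‖ ≤ C)
    (l : ι) (c : ℂ) :
    diagOp a hC ha (lp.single 2 l c) = lp.single 2 l (a l * c) := by
  ext k
  by_cases h : k = l
  · subst h; simp
  · simp [Pi.single_eq_of_ne h]

end SequenceSpace

variable {d n : ℕ}

/-! ### Orthonormality of the monomials and Fourier synthesis. -/

section Monomials

theorem conj_monomial_mul_monomial (k l : Fin n → ℤ) (y : Torus n) :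
    conj (monomial k y) * monomial l y = monomial (l - k) y := by
  simp only [monomial, ContinuousMap.coe_mk, map_prod, ← Finset.prod_mul_distrib]
  refine Finset.prod_congr rfl fun i _ => ?_
  rw [← fourier_neg, ← fourier_add, Pi.sub_apply, neg_add_eq_sub]

theorem conj_monomial_sub (k l : Fin n → ℤ) (y : Torus n) :
    conj (monomial (k - l) y) = monomial l y * conj (monomial k y) := by
  rw [← conj_monomial_mul_monomial, map_mul, Complex.conj_conj]

theorem integral_monomial (k : Fin n → ℤ) :
    ∫ y, monomial k y ∂(torusMeasure n) = if k = 0 then 1 else 0 := by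
  have h : ∀ m : ℤ, ∫ x : AddCircle (2 * Real.pi), fourier m x ∂AddCircle.haarAddCircle =
      if m = 0 then 1 else 0 := fun m => by
    have h := orthonormal_iff_ite.1 (orthonormal_fourier (T := 2 * Real.pi)) 0 m
    rw [ContinuousMap.inner_toLp] at h
    simpa [eq_comm] using h
  simp only [monomial, ContinuousMap.coe_mk]
  rw [MeasureTheory.integral_fintype_prod_eq_prod (fun i x => (fourier (k i) x : ℂ))]
  simp only [h]
  split_ifs with hk
  · simp [hk]
  · obtain ⟨i, hi⟩ := Function.ne_iff.1 hk
    exact Finset.prod_eq_zero (Finset.mem_univ i) (by simpa using hi)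

theorem orthonormal_monomialL2 : Orthonormal ℂ (monomialL2 (n := n)) := by
  rw [orthonormal_iff_ite]
  intro k l
  rw [monomialL2, monomialL2, ContinuousMap.inner_toLp]
  simp only [mul_comm (monomial l _), conj_monomial_mul_monomial]
  rw [integral_monomial]
  simp [sub_eq_zero, eq_comm]

/-- The nonzero frequencies. -/
abbrev Freq (n : ℕ) : Type := {k : Fin n → ℤ // k ≠ 0}

/-- The square summable families indexed by the nonzero frequencies. -/
abbrev SeqSpace (n : ℕ) : Type := lp (fun _ : Freq n => ℂ) 2

theorem orthonormal_monomialL2_freq :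
    Orthonormal ℂ fun k : Freq n => monomialL2 (n := n) k.1 :=
  orthonormal_monomialL2.comp _ Subtype.val_injective

/-- The isometry that sums a Fourier series without constant term. -/
noncomputable def synthesis (n : ℕ) : SeqSpace n →ₗᵢ[ℂ] Lp ℂ 2 (torusMeasure n) :=
  orthonormal_monomialL2_freq.orthogonalFamily.linearIsometry

theorem synthesis_apply (u : SeqSpace n) :
    synthesis n u = ∑' k : Freq n, u k • monomialL2 k.1 := by
  simp [synthesis, OrthogonalFamily.linearIsometry_apply]

theorem synthesis_single (k : Freq n) (c : ℂ) :
    synthesis n (lp.single 2 k c) = c • monomialL2 k.1 := by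
  simp [synthesis, OrthogonalFamily.linearIsometry_apply_single]

end Monomials

/-! ### Projected frequencies and their directions. -/

section Frequencies

theorem projNorm_nonneg (P : Matrix (Fin d) (Fin n) ℝ) (k : Fin n → ℤ) : 0 ≤ projNorm P k :=
  Real.sqrt_nonneg _

theorem projNorm_sq (P : Matrix (Fin d) (Fin n) ℝ) (k : Fin n → ℤ) :
    projNorm P k ^ 2 = ∑ j, projFreq P k j ^ 2 :=
  Real.sq_sqrt (Finset.sum_nonneg fun _ _ => by positivity)

/-- `Pk = 0` would be a rational linear relation between the columns of `P`. -/
theorem IsProjectionMatrix.projNorm_pos {P : Matrix (Fin d) (Fin n) ℝ} (hP : IsProjectionMatrix P)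
    {k : Fin n → ℤ} (hk : k ≠ 0) : 0 < projNorm P k := by
  refine (projNorm_nonneg P k).lt_of_ne' fun h => hk ?_
  have h2 := projNorm_sq P k
  rw [h, zero_pow two_ne_zero, eq_comm, Finset.sum_eq_zero_iff_of_nonneg fun _ _ => by positivity]
    at h2
  have h3 := Fintype.linearIndependent_iff.1 hP (fun i => (k i : ℚ)) (by
    ext j
    have := h2 j (Finset.mem_univ j)
    rw [sq_eq_zero_iff] at this
    simpa [projFreq, Matrix.mulVec, dotProduct, Rat.smul_def, mul_comm] using this)
  ext i
  exact_mod_cast h3 i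

/-- The `j`-th component of the unit vector in the direction of `P k`. -/
noncomputable def unitFreq (P : Matrix (Fin d) (Fin n) ℝ) (k : Fin n → ℤ) (j : Fin d) : ℝ :=
  projFreq P k j / projNorm P k

theorem sum_unitFreq_sq {P : Matrix (Fin d) (Fin n) ℝ} (hP : IsProjectionMatrix P)
    {k : Fin n → ℤ} (hk : k ≠ 0) : ∑ j, unitFreq P k j ^ 2 = 1 := by
  simp only [unitFreq, div_pow]
  rw [← Finset.sum_div, ← projNorm_sq, div_self]
  exact (pow_pos (hP.projNorm_pos hk) 2).ne'

/-- The inequality survives `Pk = 0`, where the quotients are 0 by convention. -/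
theorem sum_unitFreq_sq_le_one (P : Matrix (Fin d) (Fin n) ℝ) (k : Fin n → ℤ) :
    ∑ j, unitFreq P k j ^ 2 ≤ 1 := by
  simp only [unitFreq, div_pow]
  rw [← Finset.sum_div, ← projNorm_sq]
  exact div_self_le_one _

theorem abs_unitFreq_le_one (P : Matrix (Fin d) (Fin n) ℝ) (k : Fin n → ℤ) (j : Fin d) :
    |unitFreq P k j| ≤ 1 := by
  rw [← sq_le_one_iff_abs_le_one]
  exact (Finset.single_le_sum (f := fun j => unitFreq P k j ^ 2) (fun _ _ => by positivity)
    (Finset.mem_univ j)).trans (sum_unitFreq_sq_le_one P k)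

theorem abs_sum_unitFreq_mul_le_one (P : Matrix (Fin d) (Fin n) ℝ) (k l : Fin n → ℤ) :
    |∑ j, unitFreq P k j * unitFreq P l j| ≤ 1 := by
  rw [← sq_le_one_iff_abs_le_one]
  exact (Finset.sum_mul_sq_le_sq_mul_sq _ _ _).trans
    (mul_le_one₀ (sum_unitFreq_sq_le_one P k) (Finset.sum_nonneg fun _ _ => by positivity)
      (sum_unitFreq_sq_le_one P l))

end Frequencies

/-! ### Rescaled coefficients for the energy space. -/

section Series

variable (P : Matrix (Fin d) (Fin n) ℝ)

open Classical in
/-- The Fourier series whose coefficients, multiplied by `|P k|`, are the given ones. -/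
noncomputable def toSeries (u : SeqSpace n) : FourierSeries n :=
  fun k => if h : k ≠ 0 then u ⟨k, h⟩ / projNorm P k else 0

theorem toSeries_zero_apply (u : SeqSpace n) : toSeries P u 0 = 0 := by
  simp [toSeries]

theorem toSeries_apply (u : SeqSpace n) (k : Freq n) :
    toSeries P u k.1 = u k / projNorm P k.1 := by
  simp [toSeries, k.2]

variable {P}

theorem tsum_freq {E : Type*} [AddCommMonoid E] [TopologicalSpace E] {f : (Fin n → ℤ) → E}
    (hf : f 0 = 0) : ∑' k : Freq n, f k.1 = ∑' k, f k :=
  tsum_subtype_eq_of_support_subset (s := {k | k ≠ 0}) fun k hk h0 => hk (by rw [h0, hf])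

theorem summable_freq_iff {f : (Fin n → ℤ) → ℝ} (hf : f 0 = 0) :
    (Summable fun k : Freq n => f k.1) ↔ Summable f :=
  Subtype.val_injective.summable_iff (f := f) fun k hk => by
    by_contra h
    exact hk ⟨⟨k, fun h0 => h (by rw [h0, hf])⟩, rfl⟩

/-- Because `|Pk| > 0` for `k ≠ 0`, the rescaling can be inverted, so quantifiers over the energy
space become quantifiers over `ℓ²`. -/
theorem mem_HbarP0_one_iff {U : FourierSeries n} (hP : IsProjectionMatrix P) :
    U ∈ HbarP0 P 1 ↔ ∃ u : SeqSpace n, toSeries P u = U := by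
  have e : ∀ k : Freq n, projNorm P k.1 ^ (2 * 1 : ℝ) * ‖U k.1‖ ^ 2 =
      ‖(projNorm P k.1 : ℂ) * U k.1‖ ^ 2 := fun k => by
    rw [mul_one, Real.rpow_two, norm_mul, mul_pow, Complex.norm_real, Real.norm_eq_abs, sq_abs]
  constructor
  · rintro ⟨h0, h⟩
    rw [← summable_freq_iff (by simp [h0])] at h
    simp only [e] at h
    refine ⟨⟨fun k => projNorm P k.1 * U k.1, memℓp_two_iff_summable_sq.2 h⟩, ?_⟩
    ext k
    by_cases hk : k = 0
    · rw [hk, toSeries_zero_apply, h0]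
    · rw [toSeries_apply P _ ⟨k, hk⟩]
      have : (projNorm P k : ℂ) ≠ 0 := by exact_mod_cast (hP.projNorm_pos hk).ne'
      field_simp
  · rintro ⟨u, rfl⟩
    refine ⟨toSeries_zero_apply P u, ?_⟩
    rw [← summable_freq_iff (by simp [toSeries_zero_apply])]
    refine (lp_two_summable_sq u).congr fun k => ?_
    have : (projNorm P k.1 : ℂ) ≠ 0 := by exact_mod_cast (hP.projNorm_pos k.2).ne'
    rw [e, toSeries_apply, mul_div_cancel₀ _ this]

end Series

/-! ### The energy form as an operator on `ℓ²`: coercivity and matrix entries. -/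

section Operator

variable (P : Matrix (Fin d) (Fin n) ℝ)

/-- The map sending the rescaled coefficients of `U` to the `j`-th component of `P ∇ U`. -/
noncomputable def gradOp (j : Fin d) : SeqSpace n →L[ℂ] Lp ℂ 2 (torusMeasure n) :=
  (synthesis n).toContinuousLinearMap ∘L
    diagOp (fun k : Freq n => Complex.I * (unitFreq P k.1 j : ℂ)) zero_le_one fun k => by
      simpa using abs_unitFreq_le_one P k.1 j

theorem gradOp_single (j : Fin d) (k : Freq n) :
    gradOp P j (lp.single 2 k 1) = (Complex.I * (unitFreq P k.1 j : ℂ)) • monomialL2 k.1 := by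
  simp [gradOp, diagOp_single, synthesis_single]

theorem norm_gradOp_sq (j : Fin d) (u : SeqSpace n) :
    ‖gradOp P j u‖ ^ 2 = ∑' k : Freq n, unitFreq P k.1 j ^ 2 * ‖u k‖ ^ 2 := by
  simp only [gradOp, ContinuousLinearMap.comp_apply, LinearIsometry.coe_toContinuousLinearMap,
    LinearIsometry.norm_map, lp_two_norm_sq, diagOp_apply]
  refine tsum_congr fun k => ?_
  simp [mul_pow]

variable {P}

/-- Parseval for each component; the squared components of a unit vector sum to 1. -/
theorem sum_norm_gradOp_sq (hP : IsProjectionMatrix P) (u : SeqSpace n) :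
    ∑ j, ‖gradOp P j u‖ ^ 2 = ‖u‖ ^ 2 := by
  simp only [norm_gradOp_sq]
  rw [← Summable.tsum_finsetSum, lp_two_norm_sq]
  · refine tsum_congr fun k => ?_
    rw [← Finset.sum_mul, sum_unitFreq_sq hP k.2, one_mul]
  · intro j _
    refine Summable.of_nonneg_of_le (fun k => by positivity) (fun k => ?_) (lp_two_summable_sq u)
    exact mul_le_of_le_one_left (by positivity)
      ((sq_le_one_iff_abs_le_one _).2 (abs_unitFreq_le_one P k.1 j))

theorem projGrad_toSeries (j : Fin d) (u : SeqSpace n) :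
    projGrad P (toSeries P u) j = gradOp P j u := by
  rw [projGrad, ← tsum_freq (by simp [toSeries_zero_apply])]
  simp only [gradOp, ContinuousLinearMap.comp_apply, LinearIsometry.coe_toContinuousLinearMap,
    synthesis_apply, diagOp_apply, toSeries_apply]
  refine tsum_congr fun k => ?_
  congr 1
  simp only [unitFreq, Complex.ofReal_div]
  ring

/-- Multiplication by an essentially bounded function, on `L²` of the torus. -/
noncomputable def mulOp (a : Lp ℂ ⊤ (torusMeasure n)) :
    Lp ℂ 2 (torusMeasure n) →L[ℂ] Lp ℂ 2 (torusMeasure n) :=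
  (ContinuousLinearMap.mul ℂ ℂ).holderL (torusMeasure n) ⊤ 2 2 a

theorem coeFn_mulOp (a : Lp ℂ ⊤ (torusMeasure n)) (f : Lp ℂ 2 (torusMeasure n)) :
    mulOp a f =ᵐ[torusMeasure n] fun y => a y * f y :=
  (ContinuousLinearMap.mul ℂ ℂ).coeFn_holder a f

/-- The operator of the energy form in the rescaled coefficients. -/
noncomputable def energyOp (P : Matrix (Fin d) (Fin n) ℝ) (a : Lp ℂ ⊤ (torusMeasure n)) :
    SeqSpace n →L[ℂ] SeqSpace n :=
  ∑ j, (gradOp P j).adjoint ∘L mulOp a ∘L gradOp P j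

theorem inner_energyOp (a : Lp ℂ ⊤ (torusMeasure n)) (u v : SeqSpace n) :
    inner ℂ v (energyOp P a u) = ∑ j, inner ℂ (gradOp P j v) (mulOp a (gradOp P j u)) := by
  simp [energyOp, ContinuousLinearMap.adjoint_inner_right]

theorem inner_mulOp {A : Torus n → ℝ} {a : Lp ℂ ⊤ (torusMeasure n)}
    (ha : a =ᵐ[torusMeasure n] fun y => (A y : ℂ)) (f g : Lp ℂ 2 (torusMeasure n)) :
    inner ℂ g (mulOp a f) = ∫ y, (A y : ℂ) * (f y * conj (g y)) ∂(torusMeasure n) := by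
  rw [L2.inner_def]
  refine integral_congr_ae ?_
  filter_upwards [ha, coeFn_mulOp a f] with y h1 h2
  rw [RCLike.inner_apply, h2, h1]
  ring

theorem integrable_mul_conj {A : Torus n → ℝ} {a : Lp ℂ ⊤ (torusMeasure n)}
    (ha : a =ᵐ[torusMeasure n] fun y => (A y : ℂ)) (f g : Lp ℂ 2 (torusMeasure n)) :
    Integrable (fun y => (A y : ℂ) * (f y * conj (g y))) (torusMeasure n) := by
  refine (L2.integrable_inner (𝕜 := ℂ) g (mulOp a f)).congr ?_
  filter_upwards [ha, coeFn_mulOp a f] with y h1 h2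
  rw [RCLike.inner_apply, h2, h1]
  ring

theorem energyForm_toSeries {A : Torus n → ℝ} {a : Lp ℂ ⊤ (torusMeasure n)}
    (ha : a =ᵐ[torusMeasure n] fun y => (A y : ℂ)) (u v : SeqSpace n) :
    energyForm P A (toSeries P u) (toSeries P v) = inner ℂ v (energyOp P a u) := by
  simp only [energyForm, projGrad_toSeries, Finset.mul_sum]
  rw [integral_finsetSum _ fun j _ => integrable_mul_conj ha _ _, inner_energyOp]
  exact Finset.sum_congr rfl fun j _ => (inner_mulOp ha _ _).symm

/-- Pointwise `A |g|² ≥ α₀ |g|²` is integrated for each component of the gradient, and the gradient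
is isometric. -/
theorem le_re_inner_energyOp (hP : IsProjectionMatrix P) {A : Torus n → ℝ}
    {a : Lp ℂ ⊤ (torusMeasure n)} (ha : a =ᵐ[torusMeasure n] fun y => (A y : ℂ)) {α₀ : ℝ}
    (hα : ∀ y, α₀ ≤ A y) (u : SeqSpace n) :
    α₀ * ‖u‖ ^ 2 ≤ (inner ℂ u (energyOp P a u)).re := by
  rw [inner_energyOp, ← sum_norm_gradOp_sq hP u, Finset.mul_sum, Complex.re_sum]
  refine Finset.sum_le_sum fun j _ => ?_
  set g := gradOp P j u
  have e1 : ∀ y, ((A y : ℂ) * (g y * conj (g y))).re = A y * ‖g y‖ ^ 2 := fun y => by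
    rw [Complex.mul_conj, Complex.normSq_eq_norm_sq, ← Complex.ofReal_mul, Complex.ofReal_re]
  have hre := integral_re (integrable_mul_conj ha g g)
  have hint := (integrable_mul_conj ha g g).re
  simp only [RCLike.re_to_complex, e1] at hre hint
  rw [inner_mulOp ha, ← hre]
  have hg : ‖g‖ ^ 2 = ∫ y, ‖g y‖ ^ 2 ∂(torusMeasure n) := by
    have h := L2.inner_def (𝕜 := ℂ) g g
    rw [inner_self_eq_norm_sq_to_K] at h
    have h2 : ∫ y, inner ℂ (g y) (g y) ∂(torusMeasure n) =
        ((∫ y, ‖g y‖ ^ 2 ∂(torusMeasure n) : ℝ) : ℂ) := by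
      rw [← integral_complex_ofReal]
      refine integral_congr_ae (.of_forall fun y => ?_)
      simp [inner_self_eq_norm_sq_to_K]
    rw [h2] at h
    exact Complex.ofReal_injective (by rw [Complex.ofReal_pow]; exact h)
  rw [hg, ← integral_const_mul]
  refine integral_mono ?_ hint fun y => mul_le_mul_of_nonneg_right (hα y) (by positivity)
  exact ((Lp.memLp g).integrable_norm_pow two_ne_zero).const_mul α₀

/-- Multiplication by `A` is a Toeplitz matrix in the Fourier basis. The gradients contribute only
the cosine of the angle between `Pk` and `Pl`, so the decay of `Â` carries over with no loss from
small divisors. -/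
theorem energyOp_single_apply {A : Torus n → ℝ} {a : Lp ℂ ⊤ (torusMeasure n)}
    (ha : a =ᵐ[torusMeasure n] fun y => (A y : ℂ)) (k l : Freq n) :
    energyOp P a (lp.single 2 l 1) k =
      ((∑ j, unitFreq P k.1 j * unitFreq P l.1 j : ℝ) : ℂ) * fourierCoeffReal A (k.1 - l.1) := by
  have h1 := lp.inner_single_left (𝕜 := ℂ) k (1 : ℂ) (energyOp P a (lp.single 2 l 1))
  rw [RCLike.inner_apply, map_one, mul_one] at h1
  rw [← h1, inner_energyOp, Complex.ofReal_sum, Finset.sum_mul]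
  refine Finset.sum_congr rfl fun j _ => ?_
  have h2 : inner ℂ (monomialL2 k.1) (mulOp a (monomialL2 l.1)) =
      fourierCoeffReal A (k.1 - l.1) := by
    rw [inner_mulOp ha, fourierCoeffReal]
    refine integral_congr_ae ?_
    filter_upwards [ContinuousMap.coeFn_toLp (p := 2) (𝕜 := ℂ) (torusMeasure n) (monomial k.1),
      ContinuousMap.coeFn_toLp (p := 2) (𝕜 := ℂ) (torusMeasure n) (monomial l.1)] with y h3 h4
    rw [monomialL2, monomialL2, h3, h4, conj_monomial_sub]
  rw [gradOp_single, gradOp_single, map_smul, inner_smul_left, inner_smul_right, h2]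
  simp only [map_mul, Complex.conj_I, Complex.conj_ofReal, Complex.ofReal_mul]
  linear_combination (-(unitFreq P k.1 j : ℂ) * unitFreq P l.1 j *
    fourierCoeffReal A (k.1 - l.1)) * Complex.I_mul_I

theorem norm_energyOp_single_apply_le {A : Torus n → ℝ} {a : Lp ℂ ⊤ (torusMeasure n)}
    (ha : a =ᵐ[torusMeasure n] fun y => (A y : ℂ)) (k l : Freq n) :
    ‖energyOp P a (lp.single 2 l 1) k‖ ≤ ‖fourierCoeffReal A (k.1 - l.1)‖ := by
  rw [energyOp_single_apply ha, norm_mul, Complex.norm_real]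
  exact mul_le_of_le_one_left (norm_nonneg _) (abs_sum_unitFreq_mul_le_one P k.1 l.1)

end Operator

/-! ### Lattice sums of powers of `|k|`. -/

section FreqNorm

theorem freqNorm_eq_norm (k : Fin n → ℤ) :
    freqNorm k = ‖WithLp.toLp 2 fun i => (k i : ℝ)‖ := by
  rw [EuclideanSpace.norm_eq, freqNorm]
  simp

theorem freqNorm_nonneg (k : Fin n → ℤ) : 0 ≤ freqNorm k := Real.sqrt_nonneg _

theorem freqNorm_zero : freqNorm (0 : Fin n → ℤ) = 0 := by simp [freqNorm]

theorem one_le_freqNorm {k : Fin n → ℤ} (hk : k ≠ 0) : 1 ≤ freqNorm k := by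
  obtain ⟨i, hi⟩ := Function.ne_iff.1 hk
  rw [freqNorm, Real.one_le_sqrt]
  refine le_trans ?_ (Finset.single_le_sum (f := fun i => (k i : ℝ) ^ 2)
    (fun _ _ => by positivity) (Finset.mem_univ i))
  have h : 0 + 1 ≤ (k i) ^ 2 := Int.add_one_le_iff.2 (sq_pos_of_ne_zero hi)
  exact_mod_cast h

theorem freqNorm_pos {k : Fin n → ℤ} (hk : k ≠ 0) : 0 < freqNorm k :=
  zero_lt_one.trans_le (one_le_freqNorm hk)

theorem abs_freqNorm_sub_le (k l : Fin n → ℤ) :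
    |freqNorm k - freqNorm l| ≤ freqNorm (k - l) := by
  simp only [freqNorm_eq_norm]
  refine (abs_norm_sub_norm_le _ _).trans_eq ?_
  rw [← WithLp.toLp_sub]
  congr 2
  ext i
  simp

/-- The integer vectors embed in a lattice of rank `n`, where such sums converge above the exponent
`n`. -/
theorem summable_freqNorm_rpow_neg {N : ℝ} (hN : (n : ℝ) < N) :
    Summable fun k : Fin n → ℤ => freqNorm k ^ (-N) := by
  let b := (EuclideanSpace.basisFun (Fin n) ℝ).toBasis
  let L : Submodule ℤ (EuclideanSpace ℝ (Fin n)) := Submodule.span ℤ (Set.range b)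
  have hmem : ∀ k : Fin n → ℤ, (WithLp.toLp 2 fun i => (k i : ℝ)) ∈ L := fun k => by
    have h : (WithLp.toLp 2 fun i => (k i : ℝ)) = ∑ i, k i • b i := by
      ext i
      simp [b, Pi.single_apply]
    rw [h]
    exact Submodule.sum_mem _ fun i _ =>
      Submodule.smul_mem _ _ (Submodule.subset_span ⟨i, rfl⟩)
  have hrank : Module.finrank ℤ L = n := by
    rw [ZLattice.rank ℝ L, finrank_euclideanSpace_fin]
  have hs := ZLattice.summable_norm_rpow L (-N) (by rw [hrank]; linarith)
  have hinj : Function.Injective fun k : Fin n → ℤ => (⟨_, hmem k⟩ : L) := fun k l h => by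
    ext i
    have h1 := congrArg (fun v : L => v.1 i) h
    exact Int.cast_injective (α := ℝ) h1
  refine (hs.comp_injective hinj).congr fun k => ?_
  rw [Function.comp_apply, freqNorm_eq_norm]
  rfl

theorem summable_one_add_freqNorm_rpow_neg {N : ℝ} (hN : (n : ℝ) < N) :
    Summable fun k : Fin n → ℤ => (1 + freqNorm k) ^ (-N) := by
  have hN0 : 0 < N := (Nat.cast_nonneg n).trans_lt hN
  -- The indicator covers `k = 0`, where `0 ^ (-N)` is 0 but the left side is 1.
  have h1 : Summable fun k : Fin n → ℤ => if k = 0 then (1 : ℝ) else 0 :=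
    summable_of_hasFiniteSupport ((Set.finite_singleton 0).subset fun k hk => by
      by_contra h
      exact hk (if_neg h))
  refine Summable.of_nonneg_of_le (fun k => ?_) (fun k => ?_)
    ((summable_freqNorm_rpow_neg hN).add h1)
  · have := freqNorm_nonneg k
    positivity
  · by_cases hk : k = 0
    · simp [hk, freqNorm_zero, Real.zero_rpow (neg_ne_zero.2 hN0.ne')]
    · simp only [if_neg hk, add_zero]
      exact Real.rpow_le_rpow_of_nonpos (freqNorm_pos hk) (by linarith) (by linarith)

end FreqNorm

/-! ### Weighted regularity by conjugation. -/

section Weights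

theorem exists_abs_rpow_sub_one_le {σ η : ℝ} (hη : 0 < η) :
    ∃ t : ℝ, 0 < t ∧ ∀ r : ℝ, |r - 1| ≤ t → |r ^ σ - 1| ≤ η := by
  have h := Real.continuousAt_rpow_const 1 σ (Or.inl one_ne_zero)
  obtain ⟨δ, hδ, h⟩ := Metric.continuousAt_iff.1 h η hη
  refine ⟨δ / 2, by positivity, fun r hr => ?_⟩
  have h1 := h (x := r) (by rw [Real.dist_eq]; linarith)
  rw [Real.dist_eq, Real.one_rpow] at h1
  exact h1.le

/-- A bound for the ratio of two weights whose frequencies `x`, `y` are at a distance `m`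
comparable with the larger one. -/
theorem abs_weight_ratio_mul_le {σ N p t R x y m : ℝ} (hσ : 0 ≤ σ) (hp : 0 < p) (hpN : 2 * p < N)
    (hpσ : p ≤ N - σ) (ht : 0 < t) (hR : 1 ≤ R) (hx : 1 ≤ x) (hy : 1 ≤ y)
    (hm : t * max R y ≤ m) (hxy : |x - y| ≤ m) :
    |(max R x) ^ σ / (max R y) ^ σ - 1| * (1 + m) ^ (-N) ≤
      2 * (1 + 1 / t) ^ σ * (1 + 1 / t) ^ p * t ^ (-(N - σ - p)) * R ^ (-(N - 2 * p)) *
        (x ^ (-p) * y ^ (-p)) := by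
  set B := 1 + 1 / t with hB
  set M := max R y with hM
  have hB0 : 0 < B := by positivity
  have hM1 : 1 ≤ M := hR.trans (le_max_left _ _)
  have hM0 : 0 < M := by linarith
  have hm0 : 0 < m := (mul_pos ht hM0).trans_le hm
  have hMm : M ≤ m / t := by rw [le_div_iff₀ ht]; linarith
  -- `max R` is 1-Lipschitz, and `M ≤ m / t`; so both weights are at most `(B * m) ^ σ`.
  have hxm : max R x ≤ M + m := by
    have := abs_le.1 ((abs_max_sub_max_le_abs x y R).trans hxy)
    rw [max_comm R x, hM, max_comm R y]
    linarith
  have hBm : M + m ≤ B * m := by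
    have : B * m = m / t + m := by rw [hB]; ring
    linarith
  have hxB : x ≤ B * m := (le_max_right R x).trans (hxm.trans hBm)
  have h1 : |(max R x) ^ σ / M ^ σ - 1| ≤ 2 * B ^ σ * m ^ σ * M ^ (-σ) := by
    have hmx : 0 < max R x := by linarith [le_max_left R x]
    have e : 2 * B ^ σ * m ^ σ * M ^ (-σ) = 2 * (B * m) ^ σ / M ^ σ := by
      rw [Real.mul_rpow hB0.le hm0.le, Real.rpow_neg hM0.le]
      ring
    have hMσ : 0 < M ^ σ := by positivity
    have h2 : (max R x) ^ σ ≤ (B * m) ^ σ := Real.rpow_le_rpow hmx.le (hxm.trans hBm) hσ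
    have h3 : M ^ σ ≤ (B * m) ^ σ := Real.rpow_le_rpow hM0.le (by linarith) hσ
    have h4 : 0 ≤ (max R x) ^ σ := by positivity
    rw [e, div_sub_one hMσ.ne', abs_div, abs_of_pos hMσ]
    refine div_le_div_of_nonneg_right ?_ hMσ.le
    rw [abs_le]
    constructor <;> linarith
  have h2 : (1 + m) ^ (-N) ≤ m ^ (-N) :=
    Real.rpow_le_rpow_of_nonpos hm0 (by linarith) (by linarith)
  have h3 : m ^ σ * m ^ (-N) = m ^ (-p) * m ^ (-(N - σ - p)) := by
    rw [← Real.rpow_add hm0, ← Real.rpow_add hm0]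
    congr 1
    ring
  have h4 : m ^ (-p) ≤ B ^ p * x ^ (-p) := by
    have h5 : (B * m) ^ (-p) ≤ x ^ (-p) :=
      Real.rpow_le_rpow_of_nonpos (by linarith) hxB (by linarith)
    rw [Real.mul_rpow hB0.le hm0.le, Real.rpow_neg hB0.le] at h5
    rwa [← inv_mul_le_iff₀ (by positivity)]
  have h5 : m ^ (-(N - σ - p)) ≤ t ^ (-(N - σ - p)) * M ^ (-(N - σ - p)) := by
    rw [← Real.mul_rpow ht.le hM0.le]
    exact Real.rpow_le_rpow_of_nonpos (by positivity) hm (by linarith)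
  have h6 : M ^ (-(N - σ - p)) * M ^ (-σ) = M ^ (-p) * M ^ (-(N - 2 * p)) := by
    rw [← Real.rpow_add hM0, ← Real.rpow_add hM0]
    congr 1
    ring
  have h7 : M ^ (-p) ≤ y ^ (-p) :=
    Real.rpow_le_rpow_of_nonpos (by linarith) (le_max_right _ _) (by linarith)
  have h8 : M ^ (-(N - 2 * p)) ≤ R ^ (-(N - 2 * p)) :=
    Real.rpow_le_rpow_of_nonpos (by linarith) (le_max_left _ _) (by linarith)
  calc _ ≤ 2 * B ^ σ * m ^ σ * M ^ (-σ) * m ^ (-N) := by gcongr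
    _ = 2 * B ^ σ * M ^ (-σ) * (m ^ σ * m ^ (-N)) := by ring
    _ = 2 * B ^ σ * M ^ (-σ) * (m ^ (-p) * m ^ (-(N - σ - p))) := by rw [h3]
    _ ≤ 2 * B ^ σ * M ^ (-σ) *
        ((B ^ p * x ^ (-p)) * (t ^ (-(N - σ - p)) * M ^ (-(N - σ - p)))) := by gcongr
    _ = 2 * B ^ σ * B ^ p * x ^ (-p) * t ^ (-(N - σ - p)) *
        (M ^ (-(N - σ - p)) * M ^ (-σ)) := by ring
    _ = 2 * B ^ σ * B ^ p * x ^ (-p) * t ^ (-(N - σ - p)) *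
        (M ^ (-p) * M ^ (-(N - 2 * p))) := by rw [h6]
    _ ≤ 2 * B ^ σ * B ^ p * x ^ (-p) * t ^ (-(N - σ - p)) *
        (y ^ (-p) * R ^ (-(N - 2 * p))) := by gcongr
    _ = _ := by ring

/-- Conjugating a matrix with off-diagonal decay by the weight `max R |k| ^ σ` changes it by an
operator that is small for a suitable threshold `R`. -/
theorem exists_small_conjugation_error {σ N CA ε : ℝ} (hσ : 0 ≤ σ) (hN : (n : ℝ) < N)
    (hNσ : (n : ℝ) / 2 < N - σ) (hCA : 0 ≤ CA) (hε : 0 < ε) (b : Freq n → Freq n → ℂ)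
    (hb : ∀ k l, ‖b k l‖ ≤ CA * (1 + freqNorm (k.1 - l.1)) ^ (-N)) :
    ∃ R : ℝ, 1 ≤ R ∧ ∃ S : SeqSpace n →L[ℂ] SeqSpace n, ‖S‖ ≤ ε ∧ ∀ k l,
      S (lp.single 2 l 1) k =
        ((max R (freqNorm k.1) ^ σ / max R (freqNorm l.1) ^ σ - 1 : ℝ) : ℂ) * b k l := by
  have hw0 : ∀ k : Fin n → ℤ, 0 ≤ (1 + freqNorm k) ^ (-N) := fun k => by
    have := freqNorm_nonneg k
    positivity
  have hws := summable_one_add_freqNorm_rpow_neg hN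
  set Q := ∑' k : Fin n → ℤ, (1 + freqNorm k) ^ (-N) with hQ
  have hQ0 : 0 ≤ Q := tsum_nonneg hw0
  -- `η` makes the Schur bound `η * CA * Q` at most `ε / 2`; the `+ 1` avoids a zero denominator.
  -- Neither `η` nor `t` depends on `R`, which is chosen last.
  obtain ⟨t, ht, hη⟩ := exists_abs_rpow_sub_one_le (σ := σ) (η := ε / 2 / (CA * Q + 1))
    (by positivity)
  set η := ε / 2 / (CA * Q + 1) with hηdef
  have hη0 : 0 < η := by positivity
  have hηQ : η * CA * Q ≤ ε / 2 := by
    have : η * (CA * Q + 1) = ε / 2 := div_mul_cancel₀ _ (by positivity)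
    nlinarith
  -- `p > n / 2` makes `|k| ^ (-p)` square summable, `2 * p < N` leaves a negative power of `R`, and
  -- `p < N - σ` absorbs the growth of the weight.
  obtain ⟨p, hp1, hp2⟩ := exists_between (show (n : ℝ) / 2 < min (N / 2) (N - σ) from
    lt_min (by linarith) hNσ)
  have hpN : 2 * p < N := by linarith [hp2.trans_le (min_le_left _ _)]
  have hpσ : p ≤ N - σ := (hp2.trans_le (min_le_right _ _)).le
  have hp0 : 0 < p := lt_of_le_of_lt (by positivity) hp1
  have hφs : Summable fun k : Freq n => (freqNorm k.1 ^ (-p)) ^ 2 := by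
    refine ((summable_freqNorm_rpow_neg (n := n) (N := 2 * p)
      (by linarith)).comp_injective Subtype.val_injective).congr fun k => ?_
    rw [Function.comp_apply, ← Real.rpow_natCast, ← Real.rpow_mul (freqNorm_nonneg _)]
    congr 1
    push_cast
    ring
  set Q₂ := ∑' k : Freq n, (freqNorm k.1 ^ (-p)) ^ 2
  set C₂ := CA * (2 * (1 + 1 / t) ^ σ * (1 + 1 / t) ^ p * t ^ (-(N - σ - p))) with hC₂
  have hC₂0 : 0 ≤ C₂ := by positivity
  obtain ⟨R, hR1, hR⟩ : ∃ R : ℝ, 1 ≤ R ∧ C₂ * R ^ (-(N - 2 * p)) * Q₂ ≤ ε / 2 := by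
    have h := ((tendsto_rpow_neg_atTop (show 0 < N - 2 * p by linarith)).const_mul C₂).mul_const Q₂
    rw [mul_zero, zero_mul] at h
    obtain ⟨R, h1, h2⟩ := ((Filter.eventually_ge_atTop 1).and
      (h.eventually_le_const (show (0 : ℝ) < ε / 2 by positivity))).exists
    exact ⟨R, h1, h2⟩
  refine ⟨R, hR1, ?_⟩
  classical
  let E : Freq n → Freq n → ℂ := fun k l =>
    ((max R (freqNorm k.1) ^ σ / max R (freqNorm l.1) ^ σ - 1 : ℝ) : ℂ) * b k l
  -- The distance is measured relative to the truncated weight's base, so that on this set the ratio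
  -- of the bases is within `t` of 1.
  let near : Freq n → Freq n → Prop := fun k l =>
    freqNorm (k.1 - l.1) ≤ t * max R (freqNorm l.1)
  have hnear : ∀ k l, ‖if near k l then E k l else 0‖ ≤
      η * CA * (1 + freqNorm (k.1 - l.1)) ^ (-N) := fun k l => by
    split_ifs with h
    · have hM : 0 < max R (freqNorm l.1) := by linarith [le_max_left R (freqNorm l.1)]
      have hM' : 0 < max R (freqNorm k.1) := by linarith [le_max_left R (freqNorm k.1)]
      have h1 := hη (max R (freqNorm k.1) / max R (freqNorm l.1)) (by
        rw [div_sub_one hM.ne', abs_div, abs_of_pos hM, div_le_iff₀ hM]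
        refine le_trans ?_ h
        rw [max_comm R, max_comm R]
        exact (abs_max_sub_max_le_abs _ _ _).trans (abs_freqNorm_sub_le _ _))
      rw [Real.div_rpow hM'.le hM.le] at h1
      rw [norm_mul, Complex.norm_real, mul_assoc]
      exact mul_le_mul h1 (hb k l) (norm_nonneg _) hη0.le
    · rw [norm_zero]
      exact mul_nonneg (by positivity) (hw0 _)
  have hfar : ∀ k l, ‖if near k l then 0 else E k l‖ ≤
      C₂ * R ^ (-(N - 2 * p)) * (freqNorm k.1 ^ (-p) * freqNorm l.1 ^ (-p)) := fun k l => by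
    have hk := freqNorm_nonneg k.1
    have hl := freqNorm_nonneg l.1
    split_ifs with h
    · rw [norm_zero]
      positivity
    · have h1 := abs_weight_ratio_mul_le hσ hp0 hpN hpσ ht hR1 (one_le_freqNorm k.2)
        (one_le_freqNorm l.2) (not_le.1 h).le (abs_freqNorm_sub_le k.1 l.1)
      rw [norm_mul, Complex.norm_real, Real.norm_eq_abs]
      calc _ ≤ |max R (freqNorm k.1) ^ σ / max R (freqNorm l.1) ^ σ - 1| *
            (CA * (1 + freqNorm (k.1 - l.1)) ^ (-N)) :=
            mul_le_mul_of_nonneg_left (hb k l) (abs_nonneg _)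
        _ = CA * (|max R (freqNorm k.1) ^ σ / max R (freqNorm l.1) ^ σ - 1| *
            (1 + freqNorm (k.1 - l.1)) ^ (-N)) := by ring
        _ ≤ _ := mul_le_mul_of_nonneg_left h1 hCA
        _ = _ := by rw [hC₂]; ring
  have hinjL : ∀ k : Freq n, Function.Injective fun l : Freq n => k.1 - l.1 := fun k l l' h =>
    Subtype.ext (sub_right_injective h)
  have hinjR : ∀ l : Freq n, Function.Injective fun k : Freq n => k.1 - l.1 := fun l k k' h =>
    Subtype.ext (sub_left_injective h)
  have hle : ∀ φ : Freq n → (Fin n → ℤ), Function.Injective φ →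
      Summable (fun k => (1 + freqNorm (φ k)) ^ (-N)) ∧
        ∑' k, (1 + freqNorm (φ k)) ^ (-N) ≤ Q := fun φ hφ =>
    ⟨hws.comp_injective hφ, tsum_comp_le_tsum_of_inj hws hw0 hφ⟩
  obtain ⟨S₁, hS₁, hS₁'⟩ := exists_clm_of_schur (fun k l => if near k l then E k l else 0)
    (fun k l => η * CA * (1 + freqNorm (k.1 - l.1)) ^ (-N)) (C := ε / 2) (by positivity) hnear
    (fun k => (hle _ (hinjL k)).1.mul_left _)
    (fun k => by
      rw [tsum_mul_left]
      exact (mul_le_mul_of_nonneg_left (hle _ (hinjL k)).2 (by positivity)).trans hηQ)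
    (fun l s => by
      rw [← Finset.mul_sum]
      refine (mul_le_mul_of_nonneg_left ?_ (by positivity)).trans hηQ
      exact ((hle _ (hinjR l)).1.sum_le_tsum s fun _ _ => hw0 _).trans (hle _ (hinjR l)).2)
  obtain ⟨S₂, hS₂, hS₂'⟩ := exists_clm_of_le_mul (fun k l => if near k l then 0 else E k l)
    (fun k : Freq n => freqNorm k.1 ^ (-p)) (C := C₂ * R ^ (-(N - 2 * p))) (by positivity) hfar hφs
    (fun k => Real.rpow_nonneg (freqNorm_nonneg _) _)
  refine ⟨S₁ + S₂, ?_, fun k l => ?_⟩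
  · have := norm_add_le S₁ S₂
    linarith
  · rw [add_apply, lp.coeFn_add, Pi.add_apply, hS₁', hS₂']
    split_ifs <;> simp [E]

/-- The Lax–Milgram theorem. -/
theorem isUnit_of_coercive {T : SeqSpace n →L[ℂ] SeqSpace n} {α : ℝ} (hα : 0 < α)
    (hT : ∀ u, α * ‖u‖ ^ 2 ≤ (inner ℂ u (T u)).re) : IsUnit T := by
  refine ContinuousLinearMap.isUnit_of_forall_le_norm_inner_map T (c := ⟨α, hα.le⟩) hα fun u => ?_
  rw [norm_inner_symm]
  calc ‖u‖ ^ 2 * α = α * ‖u‖ ^ 2 := mul_comm _ _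
    _ ≤ _ := hT u
    _ ≤ _ := Complex.re_le_norm _

/-- A coercive operator with off-diagonal decay is regular: solutions inherit the weighted
summability of the right hand side. -/
theorem summable_weighted_of_coercive {T : SeqSpace n →L[ℂ] SeqSpace n} {α σ N CA : ℝ}
    (hα : 0 < α) (hT : ∀ u, α * ‖u‖ ^ 2 ≤ (inner ℂ u (T u)).re) (hσ : 0 ≤ σ) (hN : (n : ℝ) < N)
    (hNσ : (n : ℝ) / 2 < N - σ) (hCA : 0 ≤ CA)
    (hdecay : ∀ k l, ‖T (lp.single 2 l 1) k‖ ≤ CA * (1 + freqNorm (k.1 - l.1)) ^ (-N))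
    {u : SeqSpace n} (hf : Summable fun k : Freq n => freqNorm k.1 ^ (2 * σ) * ‖T u k‖ ^ 2) :
    Summable fun k : Freq n => freqNorm k.1 ^ (2 * σ) * ‖u k‖ ^ 2 := by
  obtain ⟨R, hR, S, hS, hSkl⟩ := exists_small_conjugation_error hσ hN hNσ hCA (half_pos hα)
    (fun k l => T (lp.single 2 l 1) k) hdecay
  set W : Freq n → ℝ := fun k => max R (freqNorm k.1) ^ σ with hW
  have hW1 : ∀ k, 1 ≤ W k := fun k => Real.one_le_rpow (hR.trans (le_max_left _ _)) hσ
  have hW0 : ∀ k, (W k : ℂ) ≠ 0 := fun k => by exact_mod_cast (zero_lt_one.trans_le (hW1 k)).ne'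
  -- `W` is in general unbounded on `ℓ²`. Using only its inverse keeps the conjugation `T D = D (T +
  -- S)` an identity of bounded operators.
  let D : SeqSpace n →L[ℂ] SeqSpace n := diagOp (fun k => ((W k)⁻¹ : ℂ)) zero_le_one fun k => by
    rw [norm_inv, Complex.norm_real, Real.norm_of_nonneg (zero_le_one.trans (hW1 k))]
    exact inv_le_one_of_one_le₀ (hW1 k)
  have hcomm : T ∘L D = D ∘L (T + S) := by
    classical
    refine lp_two_clm_ext fun l => ?_
    ext k
    have h1 : (lp.single 2 l ((W l : ℂ)⁻¹ * 1) : SeqSpace n) =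
        (W l : ℂ)⁻¹ • lp.single 2 l (1 : ℂ) := by
      rw [← lp.single_smul, smul_eq_mul]
    simp only [ContinuousLinearMap.comp_apply, D, diagOp_single, diagOp_apply, h1, map_smul,
      lp.coeFn_smul, Pi.smul_apply, smul_eq_mul, add_apply, lp.coeFn_add,
      Pi.add_apply, hSkl]
    have hk := hW0 k
    have hl := hW0 l
    push_cast
    change (W l : ℂ)⁻¹ * _ = (W k : ℂ)⁻¹ * (_ + ((W k : ℂ) / (W l : ℂ) - 1) * _)
    field_simp
    ring
  have hTS : IsUnit (T + S) := isUnit_of_coercive (half_pos hα) fun v => by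
    have h1 : |(inner ℂ v (S v)).re| ≤ α / 2 * ‖v‖ ^ 2 := by
      refine (Complex.abs_re_le_norm _).trans ((norm_inner_le_norm v (S v)).trans ?_)
      have h2 := S.le_of_opNorm_le hS v
      calc ‖v‖ * ‖S v‖ ≤ ‖v‖ * (α / 2 * ‖v‖) := mul_le_mul_of_nonneg_left h2 (norm_nonneg _)
        _ = _ := by ring
    rw [add_apply, inner_add_right, Complex.add_re]
    linarith [hT v, (abs_le.1 h1).1]
  have hfW : Memℓp (fun k => (W k : ℂ) * T u k) 2 := by
    refine memℓp_two_iff_summable_sq.2 (Summable.of_nonneg_of_le (fun k => by positivity)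
      (fun k => ?_) (hf.mul_left (R ^ (2 * σ))))
    have hk := one_le_freqNorm k.2
    rw [norm_mul, mul_pow, Complex.norm_real, Real.norm_of_nonneg (zero_le_one.trans (hW1 k)),
      ← mul_assoc, ← Real.mul_rpow (by linarith) (by linarith)]
    refine mul_le_mul_of_nonneg_right ?_ (by positivity)
    rw [hW, ← Real.rpow_natCast, ← Real.rpow_mul (by positivity), Nat.cast_two, mul_comm σ]
    refine Real.rpow_le_rpow (by positivity) (max_le ?_ ?_) (by positivity)
    · exact le_mul_of_one_le_right (by linarith) hk
    · exact le_mul_of_one_le_left (by linarith) hR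
  obtain ⟨v, hv⟩ := (ContinuousLinearMap.isUnit_iff_bijective.1 hTS).2 ⟨_, hfW⟩
  -- `T (D v) = D (T + S) v = D (W T u) = T u`, and `T` is injective; thus `W u = v` lies in `ℓ²`.
  have hu : D v = u := by
    refine (ContinuousLinearMap.isUnit_iff_bijective.1 (isUnit_of_coercive hα hT)).1 ?_
    change (T ∘L D) v = T u
    rw [hcomm, ContinuousLinearMap.comp_apply, hv]
    ext k
    simp only [D, diagOp_apply]
    rw [inv_mul_cancel_left₀ (hW0 k)]
  refine Summable.of_nonneg_of_le (fun k => ?_) (fun k => ?_) (lp_two_summable_sq v)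
  · have := freqNorm_nonneg k.1
    positivity
  · have h1 : v k = W k * u k := by
      rw [← hu]
      simp only [D, diagOp_apply]
      rw [mul_inv_cancel_left₀ (hW0 k)]
    rw [h1, norm_mul, mul_pow, Complex.norm_real,
      Real.norm_of_nonneg (zero_le_one.trans (hW1 k))]
    refine mul_le_mul_of_nonneg_right ?_ (by positivity)
    rw [hW, ← Real.rpow_natCast, ← Real.rpow_mul (by positivity), Nat.cast_two, mul_comm σ]
    exact Real.rpow_le_rpow (freqNorm_nonneg _) (le_max_right _ _) (by positivity)

end Weights

/-! ### Small divisors and Sobolev weights. -/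

section Bounds

theorem projNorm_le_mul_freqNorm (P : Matrix (Fin d) (Fin n) ℝ) (k : Fin n → ℤ) :
    projNorm P k ≤ √(∑ j, ∑ i, P j i ^ 2) * freqNorm k := by
  rw [projNorm, freqNorm, ← Real.sqrt_mul (Finset.sum_nonneg fun _ _ =>
    Finset.sum_nonneg fun _ _ => by positivity), Finset.sum_mul]
  exact Real.sqrt_le_sqrt (Finset.sum_le_sum fun j _ =>
    Finset.sum_mul_sq_le_sq_mul_sq Finset.univ (P j) fun i => (k i : ℝ))

/-- There are no small divisors here: for `n = 0` there is no nonzero frequency, and for `n = 1` one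
has `|Pk| = |k| |P 1|`. -/
theorem IsProjectionMatrix.exists_mul_freqNorm_le {P : Matrix (Fin d) (Fin n) ℝ}
    (hP : IsProjectionMatrix P) (hn : n ≤ 1) :
    ∃ c : ℝ, 0 < c ∧ ∀ k : Fin n → ℤ, k ≠ 0 → c * freqNorm k ≤ projNorm P k := by
  interval_cases n
  · exact ⟨1, one_pos, fun k hk => (hk (Subsingleton.elim _ _)).elim⟩
  · refine ⟨projNorm P 1, hP.projNorm_pos one_ne_zero, fun k _ => le_of_eq ?_⟩
    rw [projNorm, freqNorm, projNorm, ← Real.sqrt_mul (Finset.sum_nonneg fun _ _ => by positivity),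
      Finset.sum_mul]
    congr 1
    refine Finset.sum_congr rfl fun j _ => ?_
    simp [projFreq, Matrix.mulVec, dotProduct, mul_pow]

/-- The frequencies satisfy a Diophantine bound whose exponent `ρ` leaves enough room for the
decay rate `N`; it is only needed to improve `τ` for `n ≤ 1`. -/
theorem IsDiophantine.exists_exponent {P : Matrix (Fin d) (Fin n) ℝ} {s τ N : ℝ}
    (hD : IsDiophantine P τ) (hP : IsProjectionMatrix P) (hs : 0 ≤ s)
    (hN : (n : ℝ) + s + τ < N) :
    ∃ ρ c : ℝ, 0 < c ∧ ρ ≤ τ ∧ 0 ≤ s + 1 + ρ ∧ (n : ℝ) / 2 < N - (s + 1 + ρ) ∧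
      ∀ k : Fin n → ℤ, k ≠ 0 → c * freqNorm k ^ (-ρ) ≤ projNorm P k := by
  obtain ⟨hτ, c, hc, hD⟩ := hD
  rcases le_or_gt n 1 with hn | hn
  · obtain ⟨c', hc', h⟩ := hP.exists_mul_freqNorm_le hn
    have hn0 : (0 : ℝ) ≤ n := Nat.cast_nonneg n
    -- With `ρ = -1` the weight exponent is only `s`, and `N - s > n + τ > n / 2`.
    exact ⟨-1, c', hc', by linarith, by linarith, by linarith, by simpa using h⟩
  · have hn2 : (2 : ℝ) ≤ n := by exact_mod_cast hn
    exact ⟨τ, c, hc, le_rfl, by linarith, by linarith, hD⟩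

theorem norm_div_projNorm_sq_le {P : Matrix (Fin d) (Fin n) ℝ} {ρ c : ℝ} (hc : 0 < c)
    (h : ∀ k : Fin n → ℤ, k ≠ 0 → c * freqNorm k ^ (-ρ) ≤ projNorm P k) (k : Freq n) (z : ℂ) :
    ‖z / projNorm P k.1‖ ^ 2 ≤ c⁻¹ ^ 2 * (freqNorm k.1 ^ (2 * ρ) * ‖z‖ ^ 2) := by
  have hk := freqNorm_pos k.2
  have h1 : c * freqNorm k.1 ^ (-ρ) ≤ projNorm P k.1 := h k.1 k.2
  have h2 : 0 < c * freqNorm k.1 ^ (-ρ) := by positivity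
  have h3 : ‖z / projNorm P k.1‖ ≤ c⁻¹ * (freqNorm k.1 ^ ρ * ‖z‖) := by
    rw [norm_div, Complex.norm_real, Real.norm_of_nonneg (projNorm_nonneg P _)]
    calc ‖z‖ / projNorm P k.1 ≤ ‖z‖ / (c * freqNorm k.1 ^ (-ρ)) :=
          div_le_div_of_nonneg_left (norm_nonneg _) h2 h1
      _ = _ := by rw [Real.rpow_neg hk.le]; field_simp
  refine (pow_le_pow_left₀ (norm_nonneg _) h3 2).trans_eq ?_
  rw [mul_comm 2 ρ, Real.rpow_mul hk.le, Real.rpow_two]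
  ring

theorem freqNorm_rpow_le_one_add_sq_rpow (k : Freq n) {a b : ℝ} (hab : a ≤ b) (hb : 0 ≤ b) :
    freqNorm k.1 ^ (2 * a) ≤ (1 + freqNorm k.1 ^ 2) ^ b := by
  have hk := one_le_freqNorm k.2
  calc freqNorm k.1 ^ (2 * a) ≤ freqNorm k.1 ^ (2 * b) :=
        Real.rpow_le_rpow_of_exponent_le hk (by linarith)
    _ = (freqNorm k.1 ^ 2) ^ b := by rw [Real.rpow_mul (by linarith), Real.rpow_two]
    _ ≤ _ := Real.rpow_le_rpow (by positivity) (by linarith) hb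

theorem one_add_sq_rpow_le (k : Freq n) {b : ℝ} (hb : 0 ≤ b) :
    (1 + freqNorm k.1 ^ 2) ^ b ≤ 2 ^ b * freqNorm k.1 ^ (2 * b) := by
  have hk := one_le_freqNorm k.2
  rw [Real.rpow_mul (by linarith), Real.rpow_two, ← Real.mul_rpow (by norm_num) (by positivity)]
  exact Real.rpow_le_rpow (by positivity) (by nlinarith) hb

theorem summable_div_projNorm {P : Matrix (Fin d) (Fin n) ℝ} {ρ c σ b : ℝ} (hc : 0 < c)
    (h : ∀ k : Fin n → ℤ, k ≠ 0 → c * freqNorm k ^ (-ρ) ≤ projNorm P k) (hσ : σ + ρ ≤ b)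
    (hb : 0 ≤ b) {F : FourierSeries n} (hF : F ∈ H0 n b) :
    Summable fun k : Freq n => freqNorm k.1 ^ (2 * σ) * ‖F k.1 / projNorm P k.1‖ ^ 2 := by
  have hF' : Summable fun k : Freq n => (1 + freqNorm k.1 ^ 2) ^ b * ‖F k.1‖ ^ 2 :=
    hF.2.comp_injective Subtype.val_injective
  refine Summable.of_nonneg_of_le (fun k => ?_) (fun k => ?_) (hF'.mul_left (c⁻¹ ^ 2))
  · have := freqNorm_nonneg k.1
    positivity
  · have hk := freqNorm_pos k.2
    calc _ ≤ freqNorm k.1 ^ (2 * σ) * (c⁻¹ ^ 2 * (freqNorm k.1 ^ (2 * ρ) * ‖F k.1‖ ^ 2)) :=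
          mul_le_mul_of_nonneg_left (norm_div_projNorm_sq_le hc h k _) (by positivity)
      _ = c⁻¹ ^ 2 * (freqNorm k.1 ^ (2 * (σ + ρ)) * ‖F k.1‖ ^ 2) := by
          rw [mul_add, Real.rpow_add hk]
          ring
      _ ≤ _ := by
          gcongr
          exact freqNorm_rpow_le_one_add_sq_rpow k hσ hb

theorem toSeries_mem_H0 {P : Matrix (Fin d) (Fin n) ℝ} {ρ c b : ℝ} (hc : 0 < c)
    (h : ∀ k : Fin n → ℤ, k ≠ 0 → c * freqNorm k ^ (-ρ) ≤ projNorm P k) (hb : 0 ≤ b)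
    {u : SeqSpace n} (hu : Summable fun k : Freq n => freqNorm k.1 ^ (2 * (b + ρ)) * ‖u k‖ ^ 2) :
    toSeries P u ∈ H0 n b := by
  refine ⟨toSeries_zero_apply P u, ?_⟩
  rw [← summable_freq_iff (by simp [toSeries_zero_apply])]
  refine Summable.of_nonneg_of_le (fun k => by positivity) (fun k => ?_)
    (hu.mul_left (2 ^ b * c⁻¹ ^ 2))
  have hk := freqNorm_pos k.2
  rw [toSeries_apply]
  calc _ ≤ 2 ^ b * freqNorm k.1 ^ (2 * b) *
        (c⁻¹ ^ 2 * (freqNorm k.1 ^ (2 * ρ) * ‖u k‖ ^ 2)) :=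
        mul_le_mul (one_add_sq_rpow_le k hb) (norm_div_projNorm_sq_le hc h k _)
          (by positivity) (by positivity)
    _ = _ := by
        rw [mul_add, Real.rpow_add hk]
        ring

end Bounds

/-! ### Existence, uniqueness and regularity of the solution. -/

section VariationalProblem

theorem pairing_toSeries {P : Matrix (Fin d) (Fin n) ℝ} {F : FourierSeries n} {f : SeqSpace n}
    (hf : ∀ k : Freq n, f k = F k.1 / projNorm P k.1) (v : SeqSpace n) :
    pairing F (toSeries P v) = inner ℂ v f := by
  rw [pairing, ← tsum_freq (by simp [toSeries_zero_apply]), lp.inner_eq_tsum]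
  refine tsum_congr fun k => ?_
  rw [toSeries_apply, RCLike.inner_apply, hf, map_div₀, Complex.conj_ofReal]
  ring

theorem isVariationalSolution_toSeries_iff {P : Matrix (Fin d) (Fin n) ℝ}
    (hP : IsProjectionMatrix P) {A : Torus n → ℝ} {a : Lp ℂ ⊤ (torusMeasure n)}
    (ha : a =ᵐ[torusMeasure n] fun y => (A y : ℂ)) {F : FourierSeries n} {f : SeqSpace n}
    (hf : ∀ k : Freq n, f k = F k.1 / projNorm P k.1) (u : SeqSpace n) :
    IsVariationalSolution P A F (toSeries P u) ↔ energyOp P a u = f := by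
  constructor
  · rintro ⟨-, h⟩
    refine ext_inner_left ℂ fun v => ?_
    rw [← energyForm_toSeries ha, h _ ((mem_HbarP0_one_iff hP).2 ⟨v, rfl⟩), pairing_toSeries hf]
  · intro h
    refine ⟨(mem_HbarP0_one_iff hP).2 ⟨u, rfl⟩, fun V hV => ?_⟩
    obtain ⟨v, rfl⟩ := (mem_HbarP0_one_iff hP).1 hV
    rw [energyForm_toSeries ha, h, pairing_toSeries hf]

theorem IsElliptic.exists_lp_top {A : Torus n → ℝ} (hA : IsElliptic A)
    (hm : AEMeasurable A (torusMeasure n)) :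
    ∃ a : Lp ℂ ⊤ (torusMeasure n), a =ᵐ[torusMeasure n] fun y => (A y : ℂ) := by
  obtain ⟨α₀, α₁, h0, h⟩ := hA
  have hmem : MemLp (fun y => (A y : ℂ)) ⊤ (torusMeasure n) :=
    memLp_top_of_bound (Complex.measurable_ofReal.comp_aemeasurable hm).aestronglyMeasurable α₁
      (.of_forall fun y => by
        rw [Complex.norm_real, Real.norm_of_nonneg (h0.le.trans (h y).1)]
        exact (h y).2)
  exact ⟨hmem.toLp, hmem.coeFn_toLp⟩

theorem existsUnique_isVariationalSolution {P : Matrix (Fin d) (Fin n) ℝ}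
    (hP : IsProjectionMatrix P) {s τ N : ℝ} {A : Torus n → ℝ} (hs : 0 ≤ s)
    (hD : IsDiophantine P τ) (hm : AEMeasurable A (torusMeasure n)) (hA : IsElliptic A)
    (hdecay : HasFourierDecay A N) (hN : (n : ℝ) + s + τ < N)
    {F : FourierSeries n} (hF : F ∈ H0 n (2 * τ + s + 1)) :
    (∃! U : FourierSeries n, IsVariationalSolution P A F U) ∧
      ∀ U : FourierSeries n, IsVariationalSolution P A F U → U ∈ H0 n (s + 1) := by
  obtain ⟨a, ha⟩ := hA.exists_lp_top hm
  obtain ⟨α₀, α₁, hα₀, hα⟩ := hA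
  obtain ⟨CA, hCA, hdecay⟩ := hdecay
  obtain ⟨ρ, c, hc, hρτ, hσ, hNσ, hρ⟩ := hD.exists_exponent hP hs hN
  have hτ := hD.1
  -- Used with `σ = 0` to put `f` in `ℓ²`, and with `σ = s + 1 + ρ` for regularity. The latter needs
  -- `s + 1 + 2 * ρ ≤ 2 * τ + s + 1`: the small divisor is paid once in `f` and once in returning
  -- from `u` to `U`.
  have hfs := fun σ hσ => summable_div_projNorm (σ := σ) hc hρ hσ (by linarith) hF
  have hf2 := hfs 0 (by linarith)
  simp only [mul_zero, Real.rpow_zero, one_mul] at hf2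
  let f : SeqSpace n := ⟨fun k => F k.1 / projNorm P k.1, memℓp_two_iff_summable_sq.2 hf2⟩
  have hf : ∀ k : Freq n, f k = F k.1 / projNorm P k.1 := fun k => rfl
  have hcoer := le_re_inner_energyOp hP ha fun y => (hα y).1
  have hbij := ContinuousLinearMap.isUnit_iff_bijective.1 (isUnit_of_coercive hα₀ hcoer)
  refine ⟨?_, fun U hU => ?_⟩
  · obtain ⟨u, hu⟩ := hbij.2 f
    refine ⟨toSeries P u, (isVariationalSolution_toSeries_iff hP ha hf u).2 hu, fun V hV => ?_⟩
    obtain ⟨v, rfl⟩ := (mem_HbarP0_one_iff hP).1 hV.1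
    rw [hbij.1 (((isVariationalSolution_toSeries_iff hP ha hf v).1 hV).trans hu.symm)]
  · obtain ⟨u, rfl⟩ := (mem_HbarP0_one_iff hP).1 hU.1
    have hu := (isVariationalSolution_toSeries_iff hP ha hf u).1 hU
    refine toSeries_mem_H0 hc hρ (by linarith) ?_
    refine summable_weighted_of_coercive hα₀ hcoer hσ (by linarith) hNσ hCA.le
      (fun k l => (norm_energyOp_single_apply_le ha k l).trans (hdecay _)) ?_
    rw [hu]
    exact hfs (s + 1 + ρ) (by linarith)

end VariationalProblem

/-! ### Truncation error. -/

section Truncation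

theorem sub_fourierTrunc_apply {U : FourierSeries n} (hU : U 0 = 0) (K : ℝ) (k : Fin n → ℤ) :
    (U - fourierTrunc K U) k = if K < freqNorm k then U k else 0 := by
  classical
  by_cases hk : k = 0
  · simp [hk, fourierTrunc, hU]
  · have := freqNorm_pos hk
    by_cases hK : K < freqNorm k
    · simp [fourierTrunc, hK, hK.not_ge]
    · simp [fourierTrunc, hK, not_lt.1 hK, this]

/-- Both error norms are weighted `ℓ²` norms of the tail, so a pointwise comparison of weights for
`|k| > K` suffices. -/
theorem sqrt_tsum_sub_fourierTrunc_le {b K B : ℝ} {U : FourierSeries n} (hU : U ∈ H0 n b)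
    {w : (Fin n → ℤ) → ℝ} (hw : ∀ k, 0 ≤ w k) (hB : 0 ≤ B)
    (hwB : ∀ k, K < freqNorm k → w k ≤ B ^ 2 * (1 + freqNorm k ^ 2) ^ b) :
    √(∑' k, w k * ‖(U - fourierTrunc K U) k‖ ^ 2) ≤ B * normH b U := by
  have hle : ∀ k, w k * ‖(U - fourierTrunc K U) k‖ ^ 2 ≤
      B ^ 2 * ((1 + freqNorm k ^ 2) ^ b * ‖U k‖ ^ 2) := fun k => by
    rw [sub_fourierTrunc_apply hU.1]
    split_ifs with h
    · rw [← mul_assoc]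
      exact mul_le_mul_of_nonneg_right (hwB k h) (by positivity)
    · rw [norm_zero, zero_pow two_ne_zero, mul_zero]
      positivity
  have hs := hU.2.mul_left (B ^ 2)
  rw [normH, ← Real.sqrt_sq hB, ← Real.sqrt_mul (by positivity), ← tsum_mul_left]
  exact Real.sqrt_le_sqrt (Summable.tsum_le_tsum hle
    (.of_nonneg_of_le (fun k => mul_nonneg (hw k) (by positivity)) hle hs) hs)

theorem one_le_rpow_neg_sq_mul {K x r : ℝ} (hK : 0 < K) (hx : K < x) (hr : 0 ≤ r) :
    1 ≤ (K ^ (-r)) ^ 2 * (1 + x ^ 2) ^ r := by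
  have h1 : (K ^ r) ^ 2 ≤ (1 + x ^ 2) ^ r := by
    calc (K ^ r) ^ 2 = (K ^ 2) ^ r := by
          rw [← Real.rpow_two, ← Real.rpow_two, ← Real.rpow_mul hK.le, ← Real.rpow_mul hK.le,
            mul_comm]
      _ ≤ _ := Real.rpow_le_rpow (by positivity) (by nlinarith) hr
  rw [Real.rpow_neg hK.le, inv_pow]
  exact (le_inv_mul_iff₀ (by positivity)).2 (by linarith)

theorem normHbarP_sub_fourierTrunc_le {P : Matrix (Fin d) (Fin n) ℝ} {C s K : ℝ} (hC : 0 ≤ C)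
    (hPC : ∀ k, projNorm P k ≤ C * freqNorm k) (hs : 0 ≤ s) (hK : 0 < K) {U : FourierSeries n}
    (hU : U ∈ H0 n (s + 1)) :
    normHbarP P 1 (U - fourierTrunc K U) ≤ C * K ^ (-s) * normH (s + 1) U := by
  refine sqrt_tsum_sub_fourierTrunc_le hU
    (fun k => Real.rpow_nonneg (projNorm_nonneg P k) _) (by positivity) fun k hk => ?_
  rw [mul_one, Real.rpow_two, Real.rpow_add (by positivity), Real.rpow_one]
  have h1 := one_le_rpow_neg_sq_mul hK hk hs
  calc projNorm P k ^ 2 ≤ (C * freqNorm k) ^ 2 := pow_le_pow_left₀ (projNorm_nonneg P k) (hPC k) 2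
    _ = C ^ 2 * freqNorm k ^ 2 * 1 := by ring
    _ ≤ C ^ 2 * (1 + freqNorm k ^ 2) * ((K ^ (-s)) ^ 2 * (1 + freqNorm k ^ 2) ^ s) := by
        gcongr
        linarith
    _ = _ := by ring

theorem normL2_sub_fourierTrunc_le {b K : ℝ} (hb : 0 ≤ b) (hK : 0 < K) {U : FourierSeries n}
    (hU : U ∈ H0 n b) : normL2 (U - fourierTrunc K U) ≤ K ^ (-b) * normH b U := by
  have h := sqrt_tsum_sub_fourierTrunc_le hU (w := fun _ => 1) (K := K) (B := K ^ (-b))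
    (fun _ => zero_le_one) (by positivity) fun k hk => one_le_rpow_neg_sq_mul hK hk hb
  simp only [one_mul] at h
  exact h

end Truncation

end QuasiPer

open QuasiPer
theorem corollary3p4 {d n : ℕ} (P : Matrix (Fin d) (Fin n) ℝ) (hP : IsProjectionMatrix P) :
    ∃ C : ℝ, 0 < C ∧
      ∀ (s τ N : ℝ) (A : Torus n → ℝ), 0 ≤ s → IsDiophantine P τ →
        AEMeasurable A (torusMeasure n) → IsElliptic A → HasFourierDecay A N →
        (n : ℝ) + s + τ < N →
        ∀ F ∈ H0 n (2 * τ + s + 1),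
          (∃! U : FourierSeries n, IsVariationalSolution P A F U) ∧
          ∀ U : FourierSeries n, IsVariationalSolution P A F U →
            U ∈ H0 n (s + 1) ∧
            ∀ K : ℝ, 0 < K →
              normHbarP P 1 (U - fourierTrunc K U) ≤ C * K ^ (-s) * normH (s + 1) U ∧
              normL2 (U - fourierTrunc K U) ≤ C * K ^ (-(s + 1)) * normH (s + 1) U := by
  set p := √(∑ j, ∑ i, P j i ^ 2)
  have hp : 0 ≤ p := Real.sqrt_nonneg _
  -- `p` is the Frobenius norm of `P` and serves the energy estimate; the `1` serves the `L²`
  -- estimate and keeps the constant positive.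
  refine ⟨1 + p, by positivity, fun s τ N A hs hD hm hA hdecay hN F hF => ?_⟩
  obtain ⟨hex, hreg⟩ := existsUnique_isVariationalSolution hP hs hD hm hA hdecay hN hF
  refine ⟨hex, fun U hU => ⟨hreg U hU, fun K hK => ⟨?_, ?_⟩⟩⟩
  · refine normHbarP_sub_fourierTrunc_le (by positivity) (fun k => ?_) hs hK (hreg U hU)
    refine (projNorm_le_mul_freqNorm P k).trans ?_
    exact mul_le_mul_of_nonneg_right (by linarith) (freqNorm_nonneg k)
  · refine (normL2_sub_fourierTrunc_le (by linarith) hK (hreg U hU)).trans ?_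
    rw [mul_assoc]
    exact le_mul_of_one_le_left (mul_nonneg (by positivity) (Real.sqrt_nonneg _)) (by linarith)
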